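/- Let $\{P_\theta:\theta\in\Theta\}$ be a non-empty family of probability measures on a measurable space, let $E_\theta$ denote expectation under $P_\theta$, and let $\mathbb E[Y]:=\sup_{\theta\in\Theta}E_\theta[Y]$ be the associated sublinear expectation. Let $X_1,\dots,X_n$ be real random variables that are independent under $\mathbb E$: for each $i$ and every bounded continuous $\psi:\mathbb R^{i-1}\times\mathbb R\to\mathbb R$, $$\mathbb E[\psi((X_1,\dots,X_{i-1}),X_i)]=\mathbb E\big[\{\mathbb E[\psi(x,X_i)]\}_{x=(X_1,\dots,X_{i-1})}\big].$$ Suppose that there are $\mu\in\mathbb R$ and $\overline\sigma_i,\underline\sigma_i\ge 0$ such that, for all $i$, $$\mathbb E[X_i]=-\mathbb E[-X_i]=\mu,\qquad \mathbb E[(X_i-\mu)^2]=\overline\sigma_i^2,\qquad -\mathbb E[-(X_i-\mu)^2]=\underline\sigma_i^2 .$$ Let $\overline B_n,\underline B_n\ge 0$ with $\overline B_n^2=\sum_{i=1}^n\overline\sigma_i^2$ and $\underline B_n^2=\sum_{i=1}^n\underline\sigma_i^2$, let $Z$ be a standard Gaussian random variable, and for a Lipschitz function $\varphi:\mathbb R\to\mathbb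 R$ let $\|\varphi'\|$ be the (essential) supremum of $|\varphi'|$. If $\overline B_n>0$, then for every convex Lipschitz function $\varphi:\mathbb R\to\mathbb R$, $$\Big|\mathbb E\Big\{\varphi\Big[\sum_{i=1}^n\frac{X_i-\mu}{\overline B_n}\Big]\Big\}-E[\varphi(Z)]\Big|\le\frac{\|\varphi'\|}{\overline B_n}\sum_{i=1}^n\frac{2\overline\sigma_i^3+\mathbb E[|X_i-\mu|^3]}{\sum_{j=i}^n\overline\sigma_j^2}.$$ If $\underline B_n>0$, then for every concave Lipschitz function $\varphi:\mathbb R\to\mathbb R$, $$\Big|\mathbb E\Big\{\varphi\Big[\sum_{i=1}^n\frac{X_i-\mu}{\underline B_n}\Big]\Big\}-E[\varphi(Z)]\Big|\le\frac{\|\varphi'\|}{\underline B_n}\sum_{i=1}^n\frac{2\underline\sigma_i^2\,\overline\sigma_i+\mathbb E[|X_i-\mu|^3]}{\sum_{j=i}^n\underline\sigma_j^2}.$$ The right-hand sides are read in $[0,\infty]$ with $0/0=0$, $a/0=\infty$ for $a\in(0,\infty]$, $\infty/b=\infty$ for $b\in(0,\infty)$ and $0\cdot\infty=0$; in particular $\mathbb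 E[|X_i-\mu|^3]=\infty$ is allowed. -/

import Mathlib

open MeasureTheory ProbabilityTheory
open scoped ENNReal NNReal BoundedContinuousFunction

noncomputable section

/-- The extended expectation `E[f] = E[f⁺] - E[f⁻]` of a measurable `f : Ω → ℝ` under `Q`. It is
the Bochner integral when `f` is integrable, and `±∞` when exactly one of the two parts has infinite
expectation. (If both are infinite, the expectation does not exist, and the value is `⊥`.) -/
def extExp {Ω : Type*} [MeasurableSpace Ω] (Q : Measure Ω) (f : Ω → ℝ) : EReal :=
  ((∫⁻ ω, ENNReal.ofReal (f ω) ∂Q : ℝ≥0∞) : EReal) -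
    ((∫⁻ ω, ENNReal.ofReal (-f ω) ∂Q : ℝ≥0∞) : EReal)

/-- The sublinear expectation `𝔼[f] = sup_θ E_θ[f]` attached to a family of measures. -/
def sublinExp {Θ Ω : Type*} [MeasurableSpace Ω] (P : Θ → Measure Ω) (f : Ω → ℝ) : EReal :=
  ⨆ θ, extExp (P θ) f

/-- `Y` is independent of `X` under the sublinear expectation `𝔼`:
`𝔼[ψ(X, Y)] = 𝔼[ (𝔼[ψ(x, Y)])_{x = X} ]` for all bounded continuous `ψ`. The inner expectation is a
real number because `ψ` is bounded, and `toReal` only records this. -/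
def IsIndepOf {Θ Ω E F : Type*} [MeasurableSpace Ω] [TopologicalSpace E] [TopologicalSpace F]
    (P : Θ → Measure Ω) (Y : Ω → F) (X : Ω → E) : Prop :=
  ∀ ψ : (E × F) →ᵇ ℝ,
    sublinExp P (fun ω => ψ (X ω, Y ω)) =
      sublinExp P (fun ω => (sublinExp P (fun ω' => ψ (X ω, Y ω'))).toReal)

/-- `X₁, …, Xₙ` are independent under the sublinear expectation: each `Xᵢ` is independent of the
vector `(X₁, …, Xᵢ₋₁)` of its predecessors (an empty condition for the first one). -/
def IndepSeq {Θ Ω : Type*} [MeasurableSpace Ω] (P : Θ → Measure Ω) {n : ℕ}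
    (X : Fin n → Ω → ℝ) : Prop :=
  ∀ i : Fin n, IsIndepOf P (X i) (fun ω (j : Fin i) => X (Fin.castLE i.isLt.le j) ω)

/-- `‖φ'‖`, the (essential) supremum of `|φ'|`, where `φ` is Lipschitz and so differentiable
almost everywhere. -/
def derivNorm (φ : ℝ → ℝ) : ℝ≥0∞ := eLpNorm (deriv φ) ∞ volume

end

/-! ### Lipschitz functions on the line -/

/-! The proof is Lindeberg replacement along the heat flow. Put `Y i = X i - μ` and `f y = φ (y /
B)`. The sequence `A k` is the sublinear expectation of `f`, smoothed by the total variance of the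
indices `≥ k` and evaluated at the sum of the first `k` variables. It runs from `E[φ(Z)]` at `k = 0`
to the quantity of interest at `k = n`. By independence (`IsIndepOf.supMean_lipschitz`), each
increment reduces to a bound uniform in `x`: with `g` the smoothing of `f` by the later variances,
of sum `s`, compare `sup_θ E_θ[g(x + Y i)]` with the smoothing of `g` by variance `c ^ 2` at `x`.

Smoothing keeps `g` convex and Lipschitz with the same constant `K`. For `s > 0`, `g` has a
second-order expansion with remainder `K / (3 s) |h|³` (`LipschitzWith.exists_taylor_heat`). All
means vanish, and convexity makes the quadratic coefficient `b` nonnegative, so the supremum over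
`θ` of `g x + b E_θ[Y²]` selects exactly the upper variance. The Gaussian term with `c` the upper
deviation has the same value up to third moments. For concave `g` the supremum selects the lower
variance instead.

The Taylor bound explodes as `s → 0`. But by Jensen and the Lipschitz bound both compared quantities
lie in one interval of length `K c`. Using this when `s ≤ c ^ 2`, and Taylor otherwise, gives the
denominator `c ^ 2 + s`, which is the tail sum of variances starting at `i`
(`ofReal_le_of_le_of_le`). Errors are measured by `edist`, since third moments may be infinite. -/

theorem LipschitzWith.integrable_comp {α : Type*} [MeasurableSpace α] {Q : Measure α}
    [IsFiniteMeasure Q] {f : ℝ → ℝ} {K : ℝ≥0} (hf : LipschitzWith K f) {Y : α → ℝ}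
    (hY : Integrable Y Q) : Integrable (fun ω => f (Y ω)) Q := by
  have h1 : Integrable (fun ω => |f 0| + K * |Y ω|) Q :=
    (integrable_const _).add (hY.abs.const_mul _)
  refine h1.mono' (hf.continuous.comp_aestronglyMeasurable hY.1) (.of_forall fun ω => ?_)
  have h2 := hf.dist_le_mul (Y ω) 0
  rw [Real.dist_eq, Real.dist_eq, sub_zero] at h2
  rw [Real.norm_eq_abs]
  have h3 := abs_add_le (f (Y ω) - f 0) (f 0)
  rw [sub_add_cancel] at h3
  linarith

theorem LipschitzWith.const_add_comp {f : ℝ → ℝ} {K : ℝ≥0} (hf : LipschitzWith K f) (x : ℝ) :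
    LipschitzWith K fun y => f (x + y) := by
  refine LipschitzWith.of_dist_le_mul fun a b => ?_
  simpa using hf.dist_le_mul (x + a) (x + b)

/-- A Lipschitz function is Lipschitz with constant the essential supremum of its derivative. -/
theorem LipschitzWith.lipschitzWith_derivNorm {f : ℝ → ℝ} {K : ℝ≥0} (hf : LipschitzWith K f) :
    derivNorm f ≠ ∞ ∧ LipschitzWith (derivNorm f).toNNReal f := by
  have hb : ∀ x, ‖deriv f x‖ ≤ K := fun x => norm_deriv_le_of_lipschitz hf
  have hfin : derivNorm f ≠ ∞ := by
    unfold derivNorm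
    rw [eLpNorm_exponent_top]
    exact ne_top_of_le_ne_top ENNReal.ofReal_ne_top
      (eLpNormEssSup_le_of_ae_bound (.of_forall hb))
  refine ⟨hfin, LipschitzWith.of_dist_le_mul fun x y => ?_⟩
  have hae : ∀ᵐ z, ‖deriv f z‖ ≤ (derivNorm f).toNNReal := by
    filter_upwards [enorm_ae_le_eLpNormEssSup (deriv f) volume] with z hz
    have h2 : ‖deriv f z‖ₑ ≤ derivNorm f := by
      simpa [derivNorm, eLpNorm_exponent_top] using hz
    have h3 := ENNReal.toNNReal_mono hfin h2
    rw [← coe_nnnorm]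
    exact_mod_cast h3
  -- Absolute continuity makes `f` the integral of its derivative, so an almost everywhere bound on
  -- the derivative suffices.
  have h := (hf.lipschitzOnWith (s := Set.uIcc y x)).absolutelyContinuousOnInterval.integral_deriv_eq_sub
  rw [Real.dist_eq, Real.dist_eq, ← h, ← Real.norm_eq_abs]
  refine intervalIntegral.norm_integral_le_of_norm_le_const_ae ?_
  filter_upwards [hae] with z hz _ using hz

/-! ### The heat semigroup -/

/-- The Gaussian smoothing `x ↦ E[f(x + √t Z)]`. -/
noncomputable def heat (t : ℝ≥0) (f : ℝ → ℝ) (x : ℝ) : ℝ := ∫ y, f (x + y) ∂gaussianReal 0 t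

theorem integrable_id_gaussianReal (m : ℝ) (t : ℝ≥0) :
    Integrable (fun y : ℝ => y) (gaussianReal m t) :=
  (memLp_id_gaussianReal 1).integrable (by simp)

theorem LipschitzWith.integrable_gaussianReal {f : ℝ → ℝ} {K : ℝ≥0} (hf : LipschitzWith K f)
    (x m : ℝ) (t : ℝ≥0) : Integrable (fun y => f (x + y)) (gaussianReal m t) :=
  (hf.const_add_comp x).integrable_comp (integrable_id_gaussianReal m t)

theorem heat_zero (f : ℝ → ℝ) : heat 0 f = f := by
  ext x
  simp [heat]

theorem LipschitzWith.heat {f : ℝ → ℝ} {K : ℝ≥0} (hf : LipschitzWith K f) (t : ℝ≥0) :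
    LipschitzWith K (heat t f) := by
  refine LipschitzWith.of_dist_le_mul fun a b => ?_
  rw [dist_eq_norm, _root_.heat, _root_.heat,
    ← integral_sub (hf.integrable_gaussianReal a 0 t) (hf.integrable_gaussianReal b 0 t)]
  refine (norm_integral_le_of_norm_le_const (C := K * dist a b) (.of_forall fun y => ?_)).trans ?_
  · simpa [dist_eq_norm] using hf.dist_le_mul (a + y) (b + y)
  · simp

theorem heat_add {f : ℝ → ℝ} {K : ℝ≥0} (hf : LipschitzWith K f) (s t : ℝ≥0) :
    heat (s + t) f = heat s (heat t f) := by
  ext x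
  have h1 : gaussianReal 0 (s + t) = (gaussianReal 0 s).conv (gaussianReal 0 t) := by
    rw [gaussianReal_conv_gaussianReal, add_zero]
  unfold heat
  rw [h1, integral_conv]
  · simp_rw [add_assoc]
  · rw [← h1]
    exact hf.integrable_gaussianReal x 0 _

theorem ConvexOn.heat {f : ℝ → ℝ} {K : ℝ≥0} (hf : LipschitzWith K f)
    (hc : ConvexOn ℝ Set.univ f) (t : ℝ≥0) : ConvexOn ℝ Set.univ (heat t f) := by
  refine ⟨convex_univ, fun x _ y _ a b ha hb hab => ?_⟩
  unfold _root_.heat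
  have hx := hf.integrable_gaussianReal x 0 t
  have hy := hf.integrable_gaussianReal y 0 t
  rw [smul_eq_mul, smul_eq_mul, smul_eq_mul, smul_eq_mul, ← integral_const_mul,
    ← integral_const_mul, ← integral_add (hx.const_mul a) (hy.const_mul b)]
  refine integral_mono (hf.integrable_gaussianReal _ 0 t) ((hx.const_mul a).add (hy.const_mul b))
    fun z => ?_
  have h := hc.2 (Set.mem_univ (x + z)) (Set.mem_univ (y + z)) ha hb hab
  simp only [smul_eq_mul] at h
  convert h using 2
  linear_combination (-z) * hab

/-- Cameron–Martin: a shifted Gaussian has an explicit density. -/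
theorem integral_gaussianReal_shift {t : ℝ≥0} (ht : t ≠ 0) (f : ℝ → ℝ) (v : ℝ) :
    ∫ y, f (v + y) ∂gaussianReal 0 t =
      ∫ y, Real.exp (v * y / t - v ^ 2 / (2 * t)) * f y ∂gaussianReal 0 t := by
  have ht' : (t : ℝ) ≠ 0 := by exact_mod_cast ht
  have h1 : ∫ y, f (v + y) ∂gaussianReal 0 t = ∫ y, f y ∂gaussianReal v t := by
    have h2 := gaussianReal_map_const_add (μ := 0) (v := t) v
    rw [zero_add] at h2
    rw [← h2, (measurableEmbedding_addLeft v).integral_map]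
  rw [h1, integral_gaussianReal_eq_integral_smul ht, integral_gaussianReal_eq_integral_smul ht]
  congr 1
  ext y
  simp only [smul_eq_mul, gaussianPDFReal, sub_zero]
  rw [← mul_assoc, mul_assoc _ (Real.exp _) (Real.exp _), ← Real.exp_add]
  congr 3
  field_simp
  ring

theorem integrable_exp_gaussianReal (t : ℝ≥0) (v : ℝ) :
    Integrable (fun y => Real.exp (v * y / t - v ^ 2 / (2 * t))) (gaussianReal 0 t) := by
  have h := (integrable_exp_mul_gaussianReal (μ := 0) (v := t) (v / t)).mul_const
    (Real.exp (-(v ^ 2 / (2 * t))))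
  refine h.congr (.of_forall fun y => ?_)
  simp only
  rw [← Real.exp_add]
  congr 1
  ring

/-- Second-order expansion of the smoothing of a bounded function. -/
theorem exists_abs_heat_sub_le {ψ : ℝ → ℝ} (hψ : Measurable ψ) {K : ℝ} (hb : ∀ y, |ψ y| ≤ K)
    {t : ℝ≥0} (ht : t ≠ 0) (x : ℝ) :
    ∃ b, ∀ v, |heat t ψ (x + v) - heat t ψ x - v * b| ≤ K * v ^ 2 / t := by
  have ht' : (0 : ℝ) < t := by exact_mod_cast pos_iff_ne_zero.2 ht
  have hK : 0 ≤ K := (abs_nonneg _).trans (hb 0)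
  set γ := gaussianReal 0 t with hγ
  have hm : Measurable fun y => ψ (x + y) := hψ.comp (measurable_const_add x)
  have hbd : ∀ᵐ y ∂γ, ‖ψ (x + y)‖ ≤ K := .of_forall fun y => hb _
  -- The weight `y / t` is the derivative at `v = 0` of the Cameron–Martin density.
  refine ⟨∫ y, y / t * ψ (x + y) ∂γ, fun v => ?_⟩
  have hidt : Integrable (fun y : ℝ => y / t) γ := (integrable_id_gaussianReal 0 t).div_const _
  have hexp := integrable_exp_gaussianReal t v
  have i1 : Integrable (fun y => Real.exp (v * y / t - v ^ 2 / (2 * t)) * ψ (x + y)) γ :=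
    hexp.mul_bdd (c := K) hm.aestronglyMeasurable hbd
  have i2 : Integrable (fun y => ψ (x + y)) γ :=
    (integrable_const K).mono' hm.aestronglyMeasurable hbd
  have i3 : Integrable (fun y => y / t * ψ (x + y)) γ := hidt.mul_bdd (c := K) hm.aestronglyMeasurable hbd
  have e1 : heat t ψ (x + v) =
      ∫ y, Real.exp (v * y / t - v ^ 2 / (2 * t)) * ψ (x + y) ∂γ := by
    rw [← integral_gaussianReal_shift ht (fun y => ψ (x + y)) v]
    simp only [heat, add_assoc]
  -- `R` is the density minus its linearisation. It has mean zero, and `exp u ≥ 1 + u` gives `R ≥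
  -- -v² / (2t)`. Hence `|R| ≤ R + v² / t`, whose integral is `v² / t`.
  let R : ℝ → ℝ := fun y => Real.exp (v * y / t - v ^ 2 / (2 * t)) - 1 - v * (y / t)
  have iR : Integrable R γ := (hexp.sub (integrable_const 1)).sub (hidt.const_mul v)
  have hR0 : ∫ y, R y ∂γ = 0 := by
    have h1 := integral_gaussianReal_shift ht (fun _ => (1 : ℝ)) v
    simp only [mul_one] at h1
    have h2 : ∫ y, v * (y / t) ∂γ = 0 := by
      rw [integral_const_mul, integral_div, hγ, integral_id_gaussianReal]
      simp
    have h3 : ∫ y, R y ∂γ = ∫ y, (Real.exp (v * y / t - v ^ 2 / (2 * t)) - 1) ∂γ -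
        ∫ y, v * (y / t) ∂γ := integral_sub (hexp.sub (integrable_const 1)) (hidt.const_mul v)
    rw [h3, integral_sub hexp (integrable_const 1), h2, ← h1]
    simp
  have e2 : heat t ψ (x + v) - heat t ψ x - v * ∫ y, y / t * ψ (x + y) ∂γ =
      ∫ y, R y * ψ (x + y) ∂γ := by
    rw [e1, heat, ← integral_const_mul, ← integral_sub i1 i2]
    refine (integral_sub (i1.sub i2) (i3.const_mul v)).symm.trans ?_
    congr 1
    ext y
    simp only [R, Pi.sub_apply]
    ring
  rw [e2, ← Real.norm_eq_abs]
  have i4 : Integrable (fun y => K * (R y + v ^ 2 / t)) γ :=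
    (iR.add (integrable_const _)).const_mul K
  refine (norm_integral_le_of_norm_le i4 (.of_forall fun y => ?_)).trans ?_
  · have h1 : -(v ^ 2 / (2 * t)) ≤ R y := by
      have := Real.add_one_le_exp (v * y / t - v ^ 2 / (2 * t))
      simp only [R]
      have e : v * (y / t) = v * y / t := by ring
      rw [e]
      linarith
    have h2 : v ^ 2 / (t : ℝ) = 2 * (v ^ 2 / (2 * t)) := by field_simp
    have h3 : 0 ≤ v ^ 2 / (2 * (t : ℝ)) := by positivity
    have h4 : |R y| ≤ R y + v ^ 2 / t := by
      rw [abs_le]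
      constructor <;> linarith
    rw [norm_mul, mul_comm, Real.norm_eq_abs, Real.norm_eq_abs]
    exact mul_le_mul (hb _) h4 (abs_nonneg _) hK
  · rw [integral_const_mul, integral_add iR (integrable_const _), hR0]
    simp
    exact le_of_eq (by ring)

/-- By Rademacher `f` is differentiable Lebesgue-a.e., hence Gaussian-a.e. since `t ≠ 0`, and `K`
dominates the difference quotients. The derivative is thus the smoothing of a bounded function, to
which `exists_abs_heat_sub_le` applies. -/
theorem LipschitzWith.hasDerivAt_heat {f : ℝ → ℝ} {K : ℝ≥0} (hf : LipschitzWith K f)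
    {t : ℝ≥0} (ht : t ≠ 0) (x : ℝ) : HasDerivAt (_root_.heat t f) (_root_.heat t (deriv f) x) x := by
  have hae : ∀ᵐ y ∂gaussianReal 0 t, DifferentiableAt ℝ f (x + y) := by
    refine (gaussianReal_absolutelyContinuous 0 ht).ae_le ?_
    exact (measurePreserving_add_left volume x).quasiMeasurePreserving.ae hf.ae_differentiableAt
  refine (hasDerivAt_integral_of_dominated_loc_of_lip (F := fun x y => f (x + y))
    (bound := fun _ => (K : ℝ)) Filter.univ_mem (.of_forall fun z => ?_)
    (hf.integrable_gaussianReal x 0 t) ?_ (.of_forall fun y => ?_) (integrable_const _) ?_).2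
  · exact (hf.const_add_comp z).continuous.aestronglyMeasurable
  · exact ((measurable_deriv f).comp (measurable_const_add x)).aestronglyMeasurable
  · have h := (hf.const_add_comp y).lipschitzOnWith (s := Set.univ)
    simpa [add_comm] using h
  · filter_upwards [hae] with y hy
    exact hy.hasDerivAt.comp_add_const x y

/-- For `q = p` and `q = -p`, the function `c / 3 * v ^ 3 - q v` is nondecreasing and vanishes at
`0`. Reflection handles negative `h`. -/
theorem abs_le_cube_of_abs_deriv_le {p p' : ℝ → ℝ} (hp : ∀ v, HasDerivAt p (p' v) v) (h0 : p 0 = 0)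
    {c : ℝ} (hb : ∀ v, |p' v| ≤ c * v ^ 2) (h : ℝ) : |p h| ≤ c / 3 * |h| ^ 3 := by
  have key : ∀ q q' : ℝ → ℝ, (∀ v, HasDerivAt q (q' v) v) → q 0 = 0 → (∀ v, |q' v| ≤ c * v ^ 2) →
      ∀ h, 0 ≤ h → q h ≤ c / 3 * h ^ 3 := by
    intro q q' hq hq0 hqb h hh
    have hd : ∀ v, HasDerivAt (fun v => c / 3 * v ^ 3 - q v) (c * v ^ 2 - q' v) v := fun v => by
      refine HasDerivAt.sub ?_ (hq v)
      refine ((hasDerivAt_pow 3 v).const_mul (c / 3)).congr_deriv ?_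
      push_cast
      ring_nf
    have hm : Monotone fun v => c / 3 * v ^ 3 - q v :=
      monotone_of_hasDerivAt_nonneg hd fun v => sub_nonneg.2 ((le_abs_self _).trans (hqb v))
    have := hm hh
    simp [hq0] at this
    linarith
  have hneg : ∀ v, HasDerivAt (fun v => p (-v)) (-p' (-v)) v := fun v => by
    simpa [Function.comp_def] using (hp (-v)).comp v (hasDerivAt_neg v)
  have hbn : ∀ v, |(-p' (-v))| ≤ c * v ^ 2 := fun v => by
    rw [abs_neg]
    simpa using hb (-v)
  rcases le_total 0 h with hh | hh
  · rw [abs_of_nonneg hh, abs_le]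
    have h1 := key p p' hp h0 hb h hh
    have h2 := key (fun v => -p v) _ (fun v => (hp v).neg) (by simp [h0])
      (fun v => by rw [abs_neg]; exact hb v) h hh
    constructor <;> linarith
  · rw [abs_of_nonpos hh, abs_le]
    have h1 := key _ _ hneg (by simp [h0]) hbn (-h) (by linarith)
    have h2 := key (fun v => -p (-v)) _ (fun v => (hneg v).neg) (by simp [h0])
      (fun v => by rw [abs_neg]; exact hbn v) (-h) (by linarith)
    simp only [neg_neg] at h1 h2
    constructor <;> linarith

/-- Second-order Taylor expansion of a smoothed Lipschitz function, with cubic remainder. -/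
theorem LipschitzWith.exists_taylor_heat {f : ℝ → ℝ} {K : ℝ≥0} (hf : LipschitzWith K f)
    {t : ℝ≥0} (ht : t ≠ 0) (x : ℝ) :
    ∃ a b, ∀ h, |_root_.heat t f (x + h) - _root_.heat t f x - a * h - b * h ^ 2| ≤
      K / (3 * t) * |h| ^ 3 := by
  obtain ⟨b, hb⟩ := exists_abs_heat_sub_le (measurable_deriv f) (K := K)
    (fun y => norm_deriv_le_of_lipschitz hf) ht x
  set a := _root_.heat t (deriv f) x
  refine ⟨a, b / 2, fun h => ?_⟩
  have hd : ∀ v, HasDerivAt (fun v => _root_.heat t f (x + v) - _root_.heat t f x - a * v -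
      b / 2 * v ^ 2) (_root_.heat t (deriv f) (x + v) - a - v * b) v := fun v => by
    have h1 := (hf.hasDerivAt_heat ht (x + v)).comp_const_add x v
    have h2 := ((h1.sub_const (_root_.heat t f x)).sub ((hasDerivAt_id v).const_mul a)).sub
      ((hasDerivAt_pow 2 v).const_mul (b / 2))
    refine h2.congr_deriv ?_
    push_cast
    ring
  have := abs_le_cube_of_abs_deriv_le hd (by simp) (c := K / t)
    (fun v => (hb v).trans (le_of_eq (by ring))) h
  refine this.trans (le_of_eq ?_)
  congr 1
  field_simp

/-- Averaging the expansions at `±e` cancels the linear term, and midpoint convexity leaves `0 ≤ b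
e² + M e³`. This fails for small `e > 0` if `b < 0`. -/
theorem ConvexOn.nonneg_of_taylor {g : ℝ → ℝ} (hg : ConvexOn ℝ Set.univ g) {x a b M : ℝ}
    (h : ∀ h, |g (x + h) - g x - a * h - b * h ^ 2| ≤ M * |h| ^ 3) : 0 ≤ b := by
  by_contra! hb
  have hM : 0 ≤ M := by simpa using (abs_nonneg _).trans (h 1)
  -- With this choice `b e² + M e³ = e² (b / 2 - e) < 0`; the `+ 1` avoids dividing by zero when `M
  -- = 0`.
  set e := -b / (2 * (M + 1)) with he
  have hepos : 0 < e := by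
    rw [he]
    apply div_pos <;> linarith
  have hc := hg.2 (Set.mem_univ (x + e)) (Set.mem_univ (x + -e)) 
    (by norm_num : (0 : ℝ) ≤ 1 / 2) (by norm_num : (0 : ℝ) ≤ 1 / 2) (by norm_num)
  simp only [smul_eq_mul] at hc
  have hx : 1 / 2 * (x + e) + 1 / 2 * (x + -e) = x := by ring
  rw [hx] at hc
  have h1 := (abs_le.1 (h e)).2
  have h2 := (abs_le.1 (h (-e))).2
  rw [abs_neg, abs_of_pos hepos] at h2
  rw [abs_of_pos hepos] at h1
  have h3 : 0 ≤ b * e ^ 2 + M * e ^ 3 := by nlinarith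
  have h4 : (M + 1) * e = -b / 2 := by
    rw [he]
    field_simp
  have h5 : b * e ^ 2 + M * e ^ 3 = e ^ 2 * (b / 2 - e) := by linear_combination e ^ 2 * h4
  rw [h5] at h3
  have h6 : 0 < e ^ 2 := by positivity
  nlinarith

/-! ### Increments with mean zero -/

section Increment

variable {α : Type*} [MeasurableSpace α] {Q : Measure α} [IsProbabilityMeasure Q] {Y : α → ℝ}
  {g : ℝ → ℝ} {K : ℝ≥0}

theorem integral_abs_le_of_integral_sq_le (hY : MemLp Y 2 Q) {c : ℝ} (hc : 0 ≤ c)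
    (h : ∫ ω, Y ω ^ 2 ∂Q ≤ c ^ 2) : ∫ ω, |Y ω| ∂Q ≤ c := by
  refine abs_le_of_sq_le_sq' ?_ hc |>.2
  have h1 := variance_nonneg (fun ω => |Y ω|) Q
  rw [variance_eq_sub (X := fun ω => |Y ω|) hY.abs] at h1
  simp only [Pi.pow_apply, sq_abs] at h1
  linarith

theorem ConvexOn.le_integral_of_integral_eq_zero (hg : ConvexOn ℝ Set.univ g)
    (hL : LipschitzWith K g) (hY : Integrable Y Q) (h0 : ∫ ω, Y ω ∂Q = 0) (x : ℝ) :
    g x ≤ ∫ ω, g (x + Y ω) ∂Q := by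
  have hi : Integrable (fun ω => x + Y ω) Q := (integrable_const x).add hY
  have h := hg.map_integral_le (f := fun ω => x + Y ω) hL.continuous.continuousOn isClosed_univ
    (.of_forall fun _ => Set.mem_univ _) hi (hL.integrable_comp hi)
  rw [integral_add (integrable_const x) hY, h0] at h
  simpa using h

theorem LipschitzWith.integral_le_add (hL : LipschitzWith K g) (hY : MemLp Y 2 Q) {c : ℝ}
    (hc : 0 ≤ c) (h : ∫ ω, Y ω ^ 2 ∂Q ≤ c ^ 2) (x : ℝ) :
    ∫ ω, g (x + Y ω) ∂Q ≤ g x + K * c := by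
  have hi : Integrable Y Q := hY.integrable one_le_two
  have h1 : ∫ ω, g (x + Y ω) ∂Q ≤ ∫ ω, (g x + K * |Y ω|) ∂Q := by
    refine integral_mono ((hL.const_add_comp x).integrable_comp hi)
      ((integrable_const _).add (hi.abs.const_mul _)) fun ω => ?_
    have h2 := hL.dist_le_mul (x + Y ω) x
    rw [Real.dist_eq, Real.dist_eq, add_sub_cancel_left] at h2
    linarith [le_abs_self (g (x + Y ω) - g x)]
  rw [integral_add (integrable_const _) (hi.abs.const_mul _), integral_const_mul] at h1
  have h3 := mul_le_mul_of_nonneg_left (integral_abs_le_of_integral_sq_le hY hc h) K.coe_nonneg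
  simp only [integral_const, probReal_univ, one_smul] at h1
  linarith

/-- The linear Taylor term disappears because `Y` has mean zero. -/
theorem abs_integral_sub_le_of_taylor (hL : LipschitzWith K g) {x a b M : ℝ}
    (hT : ∀ h, |g (x + h) - g x - a * h - b * h ^ 2| ≤ M * |h| ^ 3)
    (hY : MemLp Y 2 Q) (h0 : ∫ ω, Y ω ∂Q = 0) (h3 : Integrable (fun ω => |Y ω| ^ 3) Q) :
    |∫ ω, g (x + Y ω) ∂Q - g x - b * ∫ ω, Y ω ^ 2 ∂Q| ≤ M * ∫ ω, |Y ω| ^ 3 ∂Q := by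
  have hi : Integrable Y Q := hY.integrable one_le_two
  have hg := (hL.const_add_comp x).integrable_comp hi
  have h2 : Integrable (fun ω => Y ω ^ 2) Q := hY.integrable_sq
  have hg1 : Integrable (fun ω => g (x + Y ω) - g x) Q := hg.sub (integrable_const _)
  have hg2 : Integrable (fun ω => g (x + Y ω) - g x - a * Y ω) Q := hg1.sub (hi.const_mul a)
  have e : ∫ ω, g (x + Y ω) ∂Q - g x - b * ∫ ω, Y ω ^ 2 ∂Q =
      ∫ ω, (g (x + Y ω) - g x - a * Y ω - b * Y ω ^ 2) ∂Q := by
    rw [integral_sub hg2 (h2.const_mul b), integral_sub hg1 (hi.const_mul a),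
      integral_sub hg (integrable_const _), integral_const_mul, integral_const_mul, h0]
    simp
  rw [e, ← integral_const_mul, ← Real.norm_eq_abs]
  exact norm_integral_le_of_norm_le (h3.const_mul M) (.of_forall fun ω => hT _)

end Increment

theorem integral_sq_gaussianReal (t : ℝ≥0) : ∫ y, y ^ 2 ∂gaussianReal 0 t = t := by
  have h := variance_fun_id_gaussianReal (μ := 0) (v := t)
  rw [variance_eq_sub (X := fun y : ℝ => y) (memLp_id_gaussianReal 2)] at h
  simpa using h

theorem integrable_abs_cube_gaussianReal (t : ℝ≥0) :
    Integrable (fun y : ℝ => |y| ^ 3) (gaussianReal 0 t) := by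
  have h := (memLp_id_gaussianReal (μ := 0) (v := t) 3).integrable_norm_pow (by norm_num)
  simpa using h

theorem integral_abs_cube_gaussianReal_one_le : ∫ y, |y| ^ 3 ∂gaussianReal 0 1 ≤ 2 := by
  have h1 : ∫ x in Set.Ioi (0 : ℝ), x ^ 3 * Real.exp (-(1 / 2) * x ^ 2) = 2 := by
    have h := integral_rpow_mul_exp_neg_mul_rpow (p := 2) (q := 3) (b := 1 / 2) (by norm_num)
      (by norm_num) (by norm_num)
    have e : ((3 : ℝ) + 1) / 2 = 2 := by norm_num
    have e' : -((3 : ℝ) + 1) / 2 = -2 := by norm_num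
    rw [e, e', Real.Gamma_two, Real.rpow_neg (by norm_num)] at h
    norm_num at h
    norm_num
    exact_mod_cast h
  have h2 := integral_comp_abs (f := fun x : ℝ => x ^ 3 * Real.exp (-(1 / 2) * x ^ 2))
  rw [h1] at h2
  rw [integral_gaussianReal_eq_integral_smul one_ne_zero]
  have h3 : ∀ y : ℝ, gaussianPDFReal 0 1 y • |y| ^ 3 =
      (√(2 * Real.pi))⁻¹ * (|y| ^ 3 * Real.exp (-(1 / 2) * |y| ^ 2)) := fun y => by
    simp only [gaussianPDFReal, smul_eq_mul, NNReal.coe_one, sub_zero, mul_one, sq_abs]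
    rw [mul_assoc, mul_comm (Real.exp _)]
    congr 3
    ring
  simp_rw [h3]
  rw [integral_const_mul, h2]
  -- The third absolute moment is `4 / √(2π)`, and `2π ≥ 4`.
  have h4 : (2 : ℝ) ≤ √(2 * Real.pi) := by
    refine Real.le_sqrt_of_sq_le ?_
    linarith [Real.pi_gt_three]
  calc (√(2 * Real.pi))⁻¹ * (2 * 2) ≤ 2⁻¹ * (2 * 2) := by gcongr
    _ = 2 := by norm_num

theorem integral_abs_cube_gaussianReal_le (c : ℝ≥0) :
    ∫ y, |y| ^ 3 ∂gaussianReal 0 (c ^ 2) ≤ 2 * (c : ℝ) ^ 3 := by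
  have h := gaussianReal_map_const_mul (μ := 0) (v := 1) (c : ℝ)
  have e : NNReal.mk ((c : ℝ) ^ 2) (sq_nonneg _) * 1 = c ^ 2 := by
    rw [mul_one]
    rfl
  rw [e, mul_zero] at h
  rw [← h, integral_map (measurable_const_mul _).aemeasurable (by fun_prop)]
  simp_rw [abs_mul, mul_pow, NNReal.abs_eq]
  rw [integral_const_mul, mul_comm]
  exact mul_le_mul_of_nonneg_right integral_abs_cube_gaussianReal_one_le (by positivity)

/-! ### Suprema of means -/

/-- The real-valued upper mean `sup_θ ∫ f dP_θ`. -/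
noncomputable def supMean {Θ Ω : Type*} [MeasurableSpace Ω] (P : Θ → Measure Ω) (f : Ω → ℝ) : ℝ :=
  ⨆ θ, ∫ ω, f ω ∂P θ

/-- Measurable functions with uniformly bounded second moments. -/
structure SqBdd {Θ Ω : Type*} [MeasurableSpace Ω] (P : Θ → Measure Ω) (f : Ω → ℝ) : Prop where
  measurable : Measurable f
  exists_bound : ∃ C, ∀ θ, Integrable (fun ω => f ω ^ 2) (P θ) ∧ ∫ ω, f ω ^ 2 ∂P θ ≤ C

theorem abs_iSup_sub_iSup_le {ι : Type*} [Nonempty ι] {a b : ι → ℝ} {c : ℝ}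
    (ha : BddAbove (Set.range a)) (hb : BddAbove (Set.range b)) (h : ∀ i, |a i - b i| ≤ c) :
    |(⨆ i, a i) - ⨆ i, b i| ≤ c := by
  rw [abs_le]
  constructor
  · have : ⨆ i, b i ≤ (⨆ i, a i) + c := ciSup_le fun i => by
      linarith [le_ciSup ha i, (abs_le.1 (h i)).1]
    linarith
  · have : ⨆ i, a i ≤ (⨆ i, b i) + c := ciSup_le fun i => by
      linarith [le_ciSup hb i, (abs_le.1 (h i)).2]
    linarith

theorem extExp_eq_integral {Ω : Type*} [MeasurableSpace Ω] {Q : Measure Ω} {f : Ω → ℝ}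
    (hf : Integrable f Q) : extExp Q f = ((∫ ω, f ω ∂Q : ℝ) : EReal) := by
  have h1 : ∫⁻ ω, ENNReal.ofReal (f ω) ∂Q ≠ ∞ := hf.lintegral_lt_top.ne
  have h2 : ∫⁻ ω, ENNReal.ofReal (-f ω) ∂Q ≠ ∞ := hf.neg.lintegral_lt_top.ne
  rw [integral_eq_lintegral_pos_part_sub_lintegral_neg_part hf, extExp, EReal.coe_sub,
    EReal.coe_ennreal_toReal h1, EReal.coe_ennreal_toReal h2]

theorem extExp_of_nonneg {Ω : Type*} [MeasurableSpace Ω] {Q : Measure Ω} {f : Ω → ℝ}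
    (hf : ∀ ω, 0 ≤ f ω) : extExp Q f = ((∫⁻ ω, ENNReal.ofReal (f ω) ∂Q : ℝ≥0∞) : EReal) := by
  have h : ∀ ω, ENNReal.ofReal (-f ω) = 0 := fun ω => ENNReal.ofReal_of_nonpos (by linarith [hf ω])
  simp [extExp, h]

section

variable {Θ Ω : Type*} [MeasurableSpace Ω] {P : Θ → Measure Ω}

theorem integrable_of_sublinExp_le {f : Ω → ℝ} (hm : Measurable f) (hf : ∀ ω, 0 ≤ f ω) {C : ℝ}
    (h : sublinExp P f ≤ (C : EReal)) (θ : Θ) :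
    Integrable f (P θ) ∧ ∫ ω, f ω ∂P θ ≤ C := by
  have h1 : extExp (P θ) f ≤ (C : EReal) := (le_iSup (fun θ => extExp (P θ) f) θ).trans h
  have hi : Integrable f (P θ) := by
    refine ⟨hm.aestronglyMeasurable, ?_⟩
    rw [hasFiniteIntegral_iff_ofReal (.of_forall hf)]
    rw [extExp_of_nonneg hf] at h1
    refine lt_top_iff_ne_top.2 fun h2 => ?_
    rw [h2] at h1
    exact absurd h1 (by simp)
  rw [extExp_eq_integral hi] at h1
  exact ⟨hi, by exact_mod_cast h1⟩

theorem sublinExp_eq_supMean [Nonempty Θ] {f : Ω → ℝ} (hf : ∀ θ, Integrable f (P θ))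
    (hb : BddAbove (Set.range fun θ => ∫ ω, f ω ∂P θ)) : sublinExp P f = (supMean P f : EReal) := by
  unfold sublinExp
  simp_rw [extExp_eq_integral (hf _)]
  refine le_antisymm (iSup_le fun θ => ?_) ?_
  · exact_mod_cast le_ciSup hb θ
  · refine le_of_forall_lt fun c hc => ?_
    induction c with
    | bot =>
      obtain ⟨θ⟩ := ‹Nonempty Θ›
      exact (EReal.bot_lt_coe _).trans_le (le_iSup (fun θ => ((∫ ω, f ω ∂P θ : ℝ) : EReal)) θ)
    | top => exact absurd hc (by simp)
    | coe c =>
      have hc' : c < ⨆ θ, ∫ ω, f ω ∂P θ := by exact_mod_cast hc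
      obtain ⟨θ, hθ⟩ := exists_lt_of_lt_ciSup hc'
      exact (EReal.coe_lt_coe_iff.2 hθ).trans_le
        (le_iSup (fun θ => ((∫ ω, f ω ∂P θ : ℝ) : EReal)) θ)

theorem SqBdd.memLp {f : Ω → ℝ} (hf : SqBdd P f) (θ : Θ) : MemLp f 2 (P θ) := by
  obtain ⟨C, hC⟩ := hf.exists_bound
  exact (memLp_two_iff_integrable_sq hf.measurable.aestronglyMeasurable).2 (hC θ).1

theorem SqBdd.add {f g : Ω → ℝ} (hf : SqBdd P f) (hg : SqBdd P g) : SqBdd P fun ω => f ω + g ω := by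
  obtain ⟨C, hC⟩ := hf.exists_bound
  obtain ⟨D, hD⟩ := hg.exists_bound
  have hm : Measurable fun ω => f ω + g ω := hf.measurable.add hg.measurable
  refine ⟨hm, 2 * C + 2 * D, fun θ => ?_⟩
  have hi := ((hC θ).1.const_mul 2).add ((hD θ).1.const_mul 2)
  have hle : ∀ ω, (f ω + g ω) ^ 2 ≤ 2 * f ω ^ 2 + 2 * g ω ^ 2 := fun ω => by
    nlinarith [sq_nonneg (f ω - g ω)]
  have h2 : Integrable (fun ω => (f ω + g ω) ^ 2) (P θ) :=
    hi.mono' (hm.pow_const 2).aestronglyMeasurable (.of_forall fun ω => by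
      rw [Real.norm_of_nonneg (sq_nonneg _)]
      exact hle ω)
  refine ⟨h2, (integral_mono h2 hi hle).trans ?_⟩
  have := integral_add ((hC θ).1.const_mul 2) ((hD θ).1.const_mul 2)
  refine this.le.trans ?_
  rw [integral_const_mul, integral_const_mul]
  linarith [(hC θ).2, (hD θ).2]

/-- Precomposing a bounded continuous test function with continuous maps gives another one. This
passes from the vector of predecessors to their centred sum. -/
theorem IsIndepOf.comp {E F E' F' : Type*} [TopologicalSpace E] [TopologicalSpace F]
    [TopologicalSpace E'] [TopologicalSpace F'] {Y : Ω → F} {X : Ω → E} (h : IsIndepOf P Y X)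
    {a : E → E'} {b : F → F'} (ha : Continuous a) (hb : Continuous b) :
    IsIndepOf P (fun ω => b (Y ω)) (fun ω => a (X ω)) := fun ψ => by
  exact h (ψ.compContinuous ⟨fun p => (a p.1, b p.2), by fun_prop⟩)

variable [∀ θ, IsProbabilityMeasure (P θ)]

namespace SqBdd

variable {f g : Ω → ℝ}

theorem integrable (hf : SqBdd P f) (θ : Θ) : Integrable f (P θ) :=
  (hf.memLp θ).integrable one_le_two

theorem bddAbove (hf : SqBdd P f) : BddAbove (Set.range fun θ => ∫ ω, f ω ∂P θ) := by
  obtain ⟨C, hC⟩ := hf.exists_bound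
  refine ⟨1 + C, ?_⟩
  rintro _ ⟨θ, rfl⟩
  have h1 : ∫ ω, f ω ∂P θ ≤ ∫ ω, (1 + f ω ^ 2) ∂P θ :=
    integral_mono (hf.integrable θ) ((integrable_const 1).add (hC θ).1) fun ω => by
      change f ω ≤ 1 + f ω ^ 2
      nlinarith [sq_nonneg (f ω - 1), sq_nonneg (f ω)]
  rw [integral_add (integrable_const 1) (hC θ).1] at h1
  simp at h1
  have := (hC θ).2
  simp only
  linarith

theorem sublinExp_eq [Nonempty Θ] (hf : SqBdd P f) : sublinExp P f = (supMean P f : EReal) :=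
  sublinExp_eq_supMean hf.integrable hf.bddAbove

theorem of_sq_le (hf : SqBdd P f) (hg : Measurable g) {a b : ℝ} (h : ∀ ω, g ω ^ 2 ≤ a + b * f ω ^ 2)
    (hb : 0 ≤ b) : SqBdd P g := by
  obtain ⟨C, hC⟩ := hf.exists_bound
  refine ⟨hg, a + b * C, fun θ => ?_⟩
  have h1 : Integrable (fun ω => a + b * f ω ^ 2) (P θ) :=
    (integrable_const a).add ((hC θ).1.const_mul b)
  have h2 : Integrable (fun ω => g ω ^ 2) (P θ) :=
    h1.mono' (hg.pow_const 2).aestronglyMeasurable (.of_forall fun ω => by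
      rw [Real.norm_of_nonneg (sq_nonneg _)]
      exact h ω)
  refine ⟨h2, (integral_mono h2 h1 h).trans ?_⟩
  rw [integral_add (integrable_const a) ((hC θ).1.const_mul b), integral_const_mul]
  simpa using mul_le_mul_of_nonneg_left (hC θ).2 hb

theorem of_abs_le (hg : Measurable g) {C : ℝ} (h : ∀ ω, |g ω| ≤ C) : SqBdd P g := by
  have hle : ∀ ω, g ω ^ 2 ≤ C ^ 2 := fun ω => by
    rw [← sq_abs]
    exact pow_le_pow_left₀ (abs_nonneg _) (h ω) 2
  have h0 : SqBdd P fun _ : Ω => (0 : ℝ) := ⟨measurable_const, 0, fun θ => by simp⟩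
  exact h0.of_sq_le hg (a := C ^ 2) (b := 0) (by simpa using hle) le_rfl

theorem sum {ι : Type*} {Y : ι → Ω → ℝ} (s : Finset ι) (h : ∀ i ∈ s, SqBdd P (Y i)) :
    SqBdd P fun ω => ∑ i ∈ s, Y i ω := by
  classical
  induction s using Finset.induction_on with
  | empty =>
    simp only [Finset.sum_empty]
    exact of_abs_le measurable_const (C := 0) (by simp)
  | insert a s ha ih =>
    simp_rw [Finset.sum_insert ha]
    exact (h a (Finset.mem_insert_self a s)).add
      (ih fun i hi => h i (Finset.mem_insert_of_mem hi))

end SqBdd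

theorem LipschitzWith.sq_le {f : ℝ → ℝ} {K : ℝ≥0} (hf : LipschitzWith K f) (x : ℝ) :
    f x ^ 2 ≤ 2 * f 0 ^ 2 + 2 * K ^ 2 * x ^ 2 := by
  have h := hf.dist_le_mul x 0
  rw [Real.dist_eq, Real.dist_eq, sub_zero] at h
  have h2 := pow_le_pow_left₀ (abs_nonneg _) h 2
  rw [mul_pow, sq_abs, sq_abs] at h2
  nlinarith [sq_nonneg (f x - 2 * f 0)]

theorem SqBdd.lipschitz_comp {f : ℝ → ℝ} {K : ℝ≥0} (hf : LipschitzWith K f) {S : Ω → ℝ}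
    (hS : SqBdd P S) : SqBdd P fun ω => f (S ω) :=
  hS.of_sq_le (hf.continuous.measurable.comp hS.measurable) (fun ω => hf.sq_le (S ω)) (by positivity)

theorem abs_supMean_sub_le [Nonempty Θ] {f g h : Ω → ℝ} (hf : SqBdd P f) (hg : SqBdd P g)
    {C : ℝ} (hh : ∀ θ, Integrable h (P θ) ∧ ∫ ω, h ω ∂P θ ≤ C) (hle : ∀ ω, |f ω - g ω| ≤ h ω) :
    |supMean P f - supMean P g| ≤ C := by
  refine abs_iSup_sub_iSup_le hf.bddAbove hg.bddAbove fun θ => ?_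
  rw [← integral_sub (hf.integrable θ) (hg.integrable θ), ← Real.norm_eq_abs]
  exact (norm_integral_le_of_norm_le (hh θ).1 (.of_forall hle)).trans (hh θ).2

theorem abs_supMean_sub_le_of_abs_sub_le [Nonempty Θ] {f g : Ω → ℝ} (hf : SqBdd P f)
    (hg : SqBdd P g) {C : ℝ} (hle : ∀ ω, |f ω - g ω| ≤ C) : |supMean P f - supMean P g| ≤ C :=
  abs_supMean_sub_le hf hg (h := fun _ => C) (fun θ => ⟨integrable_const C, by simp⟩) hle

theorem edist_supMean_le [Nonempty Θ] {f g : Ω → ℝ} (hf : SqBdd P f) (hg : SqBdd P g) {δ : ℝ≥0∞}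
    (hle : ∀ ω, edist (f ω) (g ω) ≤ δ) : edist (supMean P f) (supMean P g) ≤ δ := by
  rcases eq_or_ne δ ∞ with rfl | hδ
  · exact le_top
  · rw [edist_dist, Real.dist_eq]
    refine ENNReal.ofReal_le_of_le_toReal (abs_supMean_sub_le_of_abs_sub_le hf hg fun ω => ?_)
    have h := hle ω
    rw [edist_dist, Real.dist_eq] at h
    exact (ENNReal.ofReal_le_iff_le_toReal hδ).1 h

/-! ### Independence against Lipschitz functions -/

/-- Truncation of a real number to `[-N, N]`. -/
def clamp (N r : ℝ) : ℝ := max (-N) (min N r)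

theorem abs_clamp_le {N : ℝ} (hN : 0 ≤ N) (r : ℝ) : |clamp N r| ≤ N :=
  abs_le.2 ⟨le_max_left _ _, max_le (by linarith) (min_le_left _ _)⟩

theorem abs_sub_clamp_le {N : ℝ} (hN : 0 < N) (r : ℝ) : |r - clamp N r| ≤ r ^ 2 / N := by
  have h0 : 0 ≤ r ^ 2 / N := by positivity
  unfold clamp
  rcases le_total N r with h | h
  · rw [min_eq_left h, max_eq_right (by linarith), abs_of_nonneg (by linarith), le_div_iff₀ hN]
    nlinarith
  · rw [min_eq_right h]
    rcases le_total (-N) r with h' | h'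
    · rwa [max_eq_right h', sub_self, abs_zero]
    · rw [max_eq_left h', abs_of_nonpos (by linarith), le_div_iff₀ hN]
      nlinarith

theorem LipschitzWith.clamp_comp {f : ℝ → ℝ} {K : ℝ≥0} (hf : LipschitzWith K f) (N : ℝ) :
    LipschitzWith K fun x => clamp N (f x) :=
  (hf.const_min N).const_max (-N)

theorem LipschitzWith.supMean_add [Nonempty Θ] {f : ℝ → ℝ} {K : ℝ≥0} (hf : LipschitzWith K f)
    {Y : Ω → ℝ} (hY : SqBdd P Y) : LipschitzWith K fun x => supMean P fun ω => f (x + Y ω) := by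
  refine LipschitzWith.of_dist_le_mul fun x y => ?_
  refine abs_supMean_sub_le_of_abs_sub_le (hY.lipschitz_comp (hf.const_add_comp x))
    (hY.lipschitz_comp (hf.const_add_comp y)) fun ω => ?_
  simpa [Real.dist_eq] using hf.dist_le_mul (x + Y ω) (y + Y ω)

theorem IsIndepOf.supMean_bounded_lipschitz [Nonempty Θ] {S Y : Ω → ℝ} (h : IsIndepOf P Y S)
    (hS : SqBdd P S) (hY : SqBdd P Y) {f : ℝ → ℝ} {K : ℝ≥0} (hf : LipschitzWith K f) {N : ℝ}
    (hN : ∀ x, |f x| ≤ N) :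
    supMean P (fun ω => f (S ω + Y ω)) =
      supMean P (fun ω => supMean P fun ω' => f (S ω + Y ω')) := by
  let ψ : (ℝ × ℝ) →ᵇ ℝ := BoundedContinuousFunction.ofNormedAddCommGroup
    (fun p => f (p.1 + p.2)) (hf.continuous.comp (by fun_prop)) N (fun p => hN _)
  have h1 := h ψ
  have h2 : ∀ x, sublinExp P (fun ω' => ψ (x, Y ω')) =
      ((supMean P fun ω' => f (x + Y ω') : ℝ) : EReal) :=
    fun x => (hY.lipschitz_comp (hf.const_add_comp x)).sublinExp_eq
  simp_rw [h2, EReal.toReal_coe] at h1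
  rw [(hS.lipschitz_comp (hf.supMean_add hY)).sublinExp_eq] at h1
  have h3 : sublinExp P (fun ω => ψ (S ω, Y ω)) =
      ((supMean P fun ω => f (S ω + Y ω) : ℝ) : EReal) :=
    ((hS.add hY).lipschitz_comp hf).sublinExp_eq
  rw [h3] at h1
  exact_mod_cast h1

/-- Independence only speaks of bounded test functions, so `f` is truncated at `N`. Truncating `r`
costs at most `r² / N`, and uniformly bounded second moments make both sides move by `O(1 / N)`;
then `N → ∞`. -/
theorem IsIndepOf.supMean_lipschitz [Nonempty Θ] {S Y : Ω → ℝ} (h : IsIndepOf P Y S)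
    (hS : SqBdd P S) (hY : SqBdd P Y) {f : ℝ → ℝ} {K : ℝ≥0} (hf : LipschitzWith K f) :
    supMean P (fun ω => f (S ω + Y ω)) =
      supMean P (fun ω => supMean P fun ω' => f (S ω + Y ω')) := by
  obtain ⟨A, hA⟩ := ((hS.add hY).lipschitz_comp hf).exists_bound
  obtain ⟨C, hC⟩ := hY.exists_bound
  obtain ⟨D, hD⟩ := hS.exists_bound
  -- `q x` bounds `E_θ[f(x + Y)²]` uniformly in `θ`. It is quadratic in `x`, so `q (S ω)` again has
  -- uniformly bounded expectation.
  let q : ℝ → ℝ := fun x => 2 * f 0 ^ 2 + 4 * K ^ 2 * x ^ 2 + 4 * K ^ 2 * C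
  have hq : ∀ x θ, Integrable (fun ω => f (x + Y ω) ^ 2) (P θ) ∧
      ∫ ω, f (x + Y ω) ^ 2 ∂P θ ≤ q x := fun x θ => by
    have hi : Integrable (fun ω => f (x + Y ω) ^ 2) (P θ) :=
      ((hY.lipschitz_comp (hf.const_add_comp x)).memLp θ).integrable_sq
    have hj : Integrable (fun ω => 2 * f 0 ^ 2 + 4 * K ^ 2 * x ^ 2 + 4 * K ^ 2 * Y ω ^ 2) (P θ) :=
      (integrable_const _).add ((hC θ).1.const_mul _)
    refine ⟨hi, (integral_mono hi hj fun ω => ?_).trans ?_⟩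
    · have h1 := hf.sq_le (x + Y ω)
      have h2 : (x + Y ω) ^ 2 ≤ 2 * x ^ 2 + 2 * Y ω ^ 2 := by nlinarith [sq_nonneg (x - Y ω)]
      have h3 := mul_le_mul_of_nonneg_left h2 (by positivity : (0 : ℝ) ≤ 2 * K ^ 2)
      simp only
      linarith
    · rw [integral_add (integrable_const _) ((hC θ).1.const_mul _), integral_const_mul]
      have := mul_le_mul_of_nonneg_left (hC θ).2 (by positivity : (0 : ℝ) ≤ 4 * K ^ 2)
      simp only [integral_const, probReal_univ, one_smul, q]
      linarith
  let D' : ℝ := 2 * f 0 ^ 2 + 4 * K ^ 2 * C + 4 * K ^ 2 * D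
  have hD' : ∀ θ, Integrable (fun ω => q (S ω)) (P θ) ∧ ∫ ω, q (S ω) ∂P θ ≤ D' := fun θ => by
    have e : (fun ω => q (S ω)) =
        fun ω => (2 * f 0 ^ 2 + 4 * K ^ 2 * C) + 4 * K ^ 2 * S ω ^ 2 := by
      ext ω
      simp only [q]
      ring
    rw [e]
    refine ⟨(integrable_const _).add ((hD θ).1.const_mul _), ?_⟩
    rw [integral_add (integrable_const _) ((hD θ).1.const_mul _), integral_const_mul]
    have := mul_le_mul_of_nonneg_left (hD θ).2 (by positivity : (0 : ℝ) ≤ 4 * K ^ 2)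
    simp only [integral_const, probReal_univ, one_smul, D']
    linarith
  set L := supMean P (fun ω => f (S ω + Y ω))
  set R := supMean P (fun ω => supMean P fun ω' => f (S ω + Y ω'))
  have key : ∀ N : ℝ, 0 < N → |L - R| ≤ (A + D') / N := fun N hN => by
    have hfN := hf.clamp_comp N
    have e := h.supMean_bounded_lipschitz hS hY hfN fun x => abs_clamp_le hN.le (f x)
    have h1 : |L - supMean P (fun ω => clamp N (f (S ω + Y ω)))| ≤ A / N :=
      abs_supMean_sub_le ((hS.add hY).lipschitz_comp hf) ((hS.add hY).lipschitz_comp hfN)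
        (h := fun ω => f (S ω + Y ω) ^ 2 / N)
        (fun θ => ⟨(hA θ).1.div_const N, by
          rw [integral_div]
          exact div_le_div_of_nonneg_right (hA θ).2 hN.le⟩)
        fun ω => abs_sub_clamp_le hN _
    have h2 : |R - supMean P (fun ω => supMean P fun ω' => clamp N (f (S ω + Y ω')))| ≤ D' / N := by
      refine abs_supMean_sub_le (hS.lipschitz_comp (hf.supMean_add hY))
        (hS.lipschitz_comp (hfN.supMean_add hY)) (h := fun ω => q (S ω) / N)
        (fun θ => ⟨(hD' θ).1.div_const N, by
          rw [integral_div]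
          exact div_le_div_of_nonneg_right (hD' θ).2 hN.le⟩) fun ω => ?_
      exact abs_supMean_sub_le (hY.lipschitz_comp (hf.const_add_comp _))
        (hY.lipschitz_comp (hfN.const_add_comp _))
        (h := fun ω' => f (S ω + Y ω') ^ 2 / N)
        (fun θ => ⟨(hq _ θ).1.div_const N, by
          rw [integral_div]
          exact div_le_div_of_nonneg_right (hq _ θ).2 hN.le⟩)
        fun ω' => abs_sub_clamp_le hN _
    rw [← e] at h2
    rw [add_div]
    rw [abs_sub_comm] at h2
    exact (abs_sub_le _ _ _).trans (add_le_add h1 h2)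
  have hlim : Filter.Tendsto (fun N : ℝ => (A + D') / N) Filter.atTop (nhds 0) :=
    Filter.Tendsto.const_div_atTop Filter.tendsto_id _
  have h0 : |L - R| ≤ 0 := ge_of_tendsto hlim
    ((Filter.eventually_gt_atTop 0).mono fun N hN => key N hN)
  exact sub_eq_zero.1 (abs_nonpos_iff.1 h0)

/-- Lindeberg's telescoping: one-step errors along the heat flow add up. -/
theorem edist_supMean_heat_le_sum [Nonempty Θ] {Y : ℕ → Ω → ℝ} {n : ℕ}
    (hY : ∀ i < n, SqBdd P (Y i))
    (hind : ∀ i < n, IsIndepOf P (Y i) fun ω => ∑ j ∈ Finset.range i, Y j ω)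
    {f : ℝ → ℝ} {K : ℝ≥0} (hf : LipschitzWith K f) (v : ℕ → ℝ≥0) (δ : ℕ → ℝ≥0∞)
    (hstep : ∀ i < n, ∀ x,
      edist (supMean P fun ω => heat (∑ j ∈ Finset.Ico (i + 1) n, v j) f (x + Y i ω))
        (heat (v i) (heat (∑ j ∈ Finset.Ico (i + 1) n, v j) f) x) ≤ δ i) :
    edist (supMean P fun ω => f (∑ j ∈ Finset.range n, Y j ω))
      (heat (∑ j ∈ Finset.range n, v j) f 0) ≤ ∑ i ∈ Finset.range n, δ i := by
  -- The first `k` summands are the original ones; the others are replaced by an independent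
  -- Gaussian of the same total `v`.
  set A : ℕ → ℝ := fun k => supMean P fun ω =>
    heat (∑ j ∈ Finset.Ico k n, v j) f (∑ j ∈ Finset.range k, Y j ω) with hA
  have h0 : A 0 = heat (∑ j ∈ Finset.range n, v j) f 0 := by
    simp [hA, supMean]
  have hn : A n = supMean P fun ω => f (∑ j ∈ Finset.range n, Y j ω) := by
    simp [hA, heat_zero]
  rw [← h0, ← hn, edist_comm]
  refine edist_le_range_sum_of_edist_le n fun {i} hi => ?_
  have hS : SqBdd P fun ω => ∑ j ∈ Finset.range i, Y j ω :=
    SqBdd.sum _ fun j hj => hY j ((Finset.mem_range.1 hj).trans hi)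
  have hL := hf.heat (∑ j ∈ Finset.Ico (i + 1) n, v j)
  have e1 : A (i + 1) = supMean P fun ω => supMean P fun ω' =>
      heat (∑ j ∈ Finset.Ico (i + 1) n, v j) f (∑ j ∈ Finset.range i, Y j ω + Y i ω') := by
    simp only [hA, Finset.sum_range_succ]
    exact (hind i hi).supMean_lipschitz hS (hY i hi) hL
  have e2 : A i = supMean P fun ω => heat (v i) (heat (∑ j ∈ Finset.Ico (i + 1) n, v j) f)
      (∑ j ∈ Finset.range i, Y j ω) := by
    simp only [hA, Finset.sum_eq_sum_Ico_succ_bot hi, heat_add hf]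
  rw [e1, e2, edist_comm]
  exact edist_supMean_le (hS.lipschitz_comp (hL.supMean_add (hY i hi)))
    (hS.lipschitz_comp (hL.heat (v i))) fun ω => hstep i hi _

end

/-! ### One-step comparison with the heat semigroup -/

section OneStep

variable {Θ Ω : Type*} [MeasurableSpace Ω] {P : Θ → Measure Ω}

theorem SqBdd.bddAbove_sq {Y : Ω → ℝ} (hY : SqBdd P Y) :
    BddAbove (Set.range fun θ => ∫ ω, Y ω ^ 2 ∂P θ) := by
  obtain ⟨C, hC⟩ := hY.exists_bound
  exact ⟨C, by rintro _ ⟨θ, rfl⟩; exact (hC θ).2⟩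

theorem bddAbove_integral_neg_sq (P : Θ → Measure Ω) (Y : Ω → ℝ) :
    BddAbove (Set.range fun θ => ∫ ω, -Y ω ^ 2 ∂P θ) := by
  refine ⟨0, ?_⟩
  rintro _ ⟨θ, rfl⟩
  exact integral_nonpos fun ω => by simpa using sq_nonneg (Y ω)

theorem integrable_abs_cube_of_sublinExp_ne_top {Y : Ω → ℝ} (hY : Measurable Y)
    (h : (sublinExp P fun ω => |Y ω| ^ 3).toENNReal ≠ ∞) (θ : Θ) :
    Integrable (fun ω => |Y ω| ^ 3) (P θ) ∧
      ∫ ω, |Y ω| ^ 3 ∂P θ ≤ (sublinExp P fun ω => |Y ω| ^ 3).toENNReal.toReal := by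
  refine integrable_of_sublinExp_le (by fun_prop) (fun ω => by positivity) ?_ θ
  rw [EReal.coe_ennreal_toReal h]
  rw [EReal.coe_toENNReal_eq_max]
  exact le_max_right _ _

variable [∀ θ, IsProbabilityMeasure (P θ)]
  {Y : Ω → ℝ} {g : ℝ → ℝ} {K c : ℝ≥0}

/-- Jensen gives the lower end; the Lipschitz bound and `E|N| ≤ c`, for `N` centred Gaussian of
variance `c ^ 2`, give the upper one. -/
theorem ConvexOn.heat_mem_Icc (hg : ConvexOn ℝ Set.univ g) (hL : LipschitzWith K g) (x : ℝ) :
    _root_.heat (c ^ 2) g x ∈ Set.Icc (g x) (g x + K * c) :=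
  ⟨hg.le_integral_of_integral_eq_zero hL (integrable_id_gaussianReal 0 _)
      integral_id_gaussianReal x,
    hL.integral_le_add (memLp_id_gaussianReal 2) c.2
      (by simp [integral_sq_gaussianReal]) x⟩

/-- Both quantities lie in `[g x, g x + K c]`. No smoothness of `g` is needed, so this also serves
when no variance remains. -/
theorem ConvexOn.abs_supMean_sub_heat_le [Nonempty Θ] (hY : SqBdd P Y)
    (h0 : ∀ θ, ∫ ω, Y ω ∂P θ = 0) (hg : ConvexOn ℝ Set.univ g) (hL : LipschitzWith K g)
    (hvar : supMean P (fun ω => Y ω ^ 2) = (c : ℝ) ^ 2) (x : ℝ) :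
    |supMean P (fun ω => g (x + Y ω)) - _root_.heat (c ^ 2) g x| ≤ K * c := by
  have hh := hg.heat_mem_Icc (c := c) hL x
  have h1 : ∀ θ, ∫ ω, g (x + Y ω) ∂P θ ≤ g x + K * c := fun θ =>
    hL.integral_le_add (hY.memLp θ) c.2 ((le_ciSup hY.bddAbove_sq θ).trans hvar.le) x
  have h2 : supMean P (fun ω => g (x + Y ω)) ≤ g x + K * c := ciSup_le h1
  have h3 : g x ≤ supMean P (fun ω => g (x + Y ω)) := by
    obtain ⟨θ⟩ := ‹Nonempty Θ›
    exact (hg.le_integral_of_integral_eq_zero hL (hY.integrable θ) (h0 θ) x).trans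
      (le_ciSup (hY.lipschitz_comp (hL.const_add_comp x)).bddAbove θ)
  rw [abs_le]
  constructor <;> linarith [hh.1, hh.2]

theorem ConvexOn.abs_supMean_neg_add_heat_le [Nonempty Θ] (hY : SqBdd P Y)
    (h0 : ∀ θ, ∫ ω, Y ω ∂P θ = 0) (hg : ConvexOn ℝ Set.univ g) (hL : LipschitzWith K g)
    (hvar : supMean P (fun ω => -Y ω ^ 2) = -(c : ℝ) ^ 2) (x : ℝ) :
    |supMean P (fun ω => -g (x + Y ω)) + _root_.heat (c ^ 2) g x| ≤ K * c := by
  have hh := hg.heat_mem_Icc (c := c) hL x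
  have h1 : supMean P (fun ω => -g (x + Y ω)) ≤ -g x := ciSup_le fun θ => by
    rw [integral_neg]
    exact neg_le_neg (hg.le_integral_of_integral_eq_zero hL (hY.integrable θ) (h0 θ) x)
  have hb : BddAbove (Set.range fun θ => ∫ ω, -g (x + Y ω) ∂P θ) :=
    (hY.lipschitz_comp (hL.const_add_comp x).neg).bddAbove
  -- The lower variance need not be attained: for each `d > c` some `θ` has second moment below `d ^
  -- 2`, and then `d` decreases to `c`.
  have h2 : ∀ d : ℝ, (c : ℝ) < d → -g x - K * d ≤ supMean P (fun ω => -g (x + Y ω)) := by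
    intro d hd
    have hcd : -d ^ 2 < supMean P (fun ω => -Y ω ^ 2) := by
      rw [hvar]
      exact neg_lt_neg (pow_lt_pow_left₀ hd c.2 two_ne_zero)
    obtain ⟨θ, hθ⟩ := exists_lt_of_lt_ciSup hcd
    rw [integral_neg] at hθ
    have h3 := hL.integral_le_add (hY.memLp θ) (c.2.trans hd.le) (neg_lt_neg_iff.1 hθ).le x
    have h4 := le_ciSup hb θ
    simp only [integral_neg] at h4
    have h5 : supMean P (fun ω => -g (x + Y ω)) = ⨆ θ, -∫ ω, g (x + Y ω) ∂P θ := by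
      simp only [supMean, integral_neg]
    rw [h5]
    linarith
  have h3 : -g x - K * c ≤ supMean P (fun ω => -g (x + Y ω)) := by
    have hcont : Filter.Tendsto (fun d : ℝ => -g x - K * d) (nhdsWithin (c : ℝ) (Set.Ioi c))
        (nhds (-g x - K * c)) := by
      have : Continuous fun d : ℝ => -g x - K * d := by fun_prop
      exact (this.tendsto _).mono_left nhdsWithin_le_nhds
    exact le_of_tendsto hcont (by filter_upwards [self_mem_nhdsWithin] with d hd using h2 d hd)
  rw [abs_le]
  constructor <;> linarith [hh.1, hh.2]

/-- An affine comparison of integrals, uniform in `θ`, passes to suprema. -/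
theorem abs_iSup_sub_affine_le {ι : Type*} [Nonempty ι] {A V : ι → ℝ} {a b D : ℝ} (hb : 0 ≤ b)
    (hA : BddAbove (Set.range A)) (hV : BddAbove (Set.range V))
    (h : ∀ i, |A i - (a + b * V i)| ≤ D) : |(⨆ i, A i) - (a + b * ⨆ i, V i)| ≤ D := by
  obtain ⟨C, hC⟩ := hV
  have hbd : BddAbove (Set.range fun i => a + b * V i) := ⟨a + b * C, by
    rintro _ ⟨i, rfl⟩
    have := mul_le_mul_of_nonneg_left (hC ⟨i, rfl⟩) hb
    simp only
    linarith⟩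
  have e : a + b * ⨆ i, V i = ⨆ i, (a + b * V i) := by
    have hm : Monotone fun r : ℝ => a + b * r := fun r s hrs => by
      have := mul_le_mul_of_nonneg_left hrs hb
      simp only
      linarith
    exact hm.map_ciSup_of_continuousAt (by fun_prop) ⟨C, hC⟩
  rw [e]
  exact abs_iSup_sub_iSup_le hA hbd h

theorem abs_heat_sq_sub_le_of_taylor (hL : LipschitzWith K g) {x a b M : ℝ} (hM : 0 ≤ M)
    (hT : ∀ h, |g (x + h) - g x - a * h - b * h ^ 2| ≤ M * |h| ^ 3) :
    |heat (c ^ 2) g x - g x - b * (c : ℝ) ^ 2| ≤ M * (2 * (c : ℝ) ^ 3) := by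
  have h := abs_integral_sub_le_of_taylor hL hT (Q := gaussianReal 0 (c ^ 2)) (Y := fun y => y)
    (memLp_id_gaussianReal 2) integral_id_gaussianReal (integrable_abs_cube_gaussianReal _)
  rw [integral_sq_gaussianReal, NNReal.coe_pow] at h
  exact h.trans (mul_le_mul_of_nonneg_left (integral_abs_cube_gaussianReal_le c) hM)

/-- Up to `M T`, each `θ` contributes `g x + b E_θ[Y²]`. As `b ≥ 0`, the supremum passes to the
second moment and yields `c ^ 2`, as for the Gaussian. -/
theorem abs_supMean_sub_heat_le_of_taylor [Nonempty Θ] (hY : SqBdd P Y)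
    (h0 : ∀ θ, ∫ ω, Y ω ∂P θ = 0) (hL : LipschitzWith K g)
    (hvar : supMean P (fun ω => Y ω ^ 2) = (c : ℝ) ^ 2) {x a b M : ℝ} (hb : 0 ≤ b) (hM : 0 ≤ M)
    (hT : ∀ h, |g (x + h) - g x - a * h - b * h ^ 2| ≤ M * |h| ^ 3) {T : ℝ}
    (h3 : ∀ θ, Integrable (fun ω => |Y ω| ^ 3) (P θ) ∧ ∫ ω, |Y ω| ^ 3 ∂P θ ≤ T) :
    |supMean P (fun ω => g (x + Y ω)) - heat (c ^ 2) g x| ≤ M * (T + 2 * (c : ℝ) ^ 3) := by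
  have h1 := abs_heat_sq_sub_le_of_taylor (c := c) hL hM hT
  have h2 : |supMean P (fun ω => g (x + Y ω)) - (g x + b * supMean P (fun ω => Y ω ^ 2))|
      ≤ M * T := by
    refine abs_iSup_sub_affine_le hb (hY.lipschitz_comp (hL.const_add_comp x)).bddAbove
      hY.bddAbove_sq fun θ => ?_
    rw [← sub_sub]
    exact (abs_integral_sub_le_of_taylor hL hT (hY.memLp θ) (h0 θ) (h3 θ).1).trans
      (mul_le_mul_of_nonneg_left (h3 θ).2 hM)
  rw [hvar] at h2
  rw [abs_le] at h1 h2 ⊢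
  constructor <;> linarith [h1.1, h1.2, h2.1, h2.2]

/-- The sign change turns the supremum of second moments into their infimum, so the matching
Gaussian has the lower variance. -/
theorem abs_supMean_neg_add_heat_le_of_taylor [Nonempty Θ] (hY : SqBdd P Y)
    (h0 : ∀ θ, ∫ ω, Y ω ∂P θ = 0) (hL : LipschitzWith K g)
    (hvar : supMean P (fun ω => -Y ω ^ 2) = -(c : ℝ) ^ 2) {x a b M : ℝ} (hb : 0 ≤ b) (hM : 0 ≤ M)
    (hT : ∀ h, |g (x + h) - g x - a * h - b * h ^ 2| ≤ M * |h| ^ 3) {T : ℝ}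
    (h3 : ∀ θ, Integrable (fun ω => |Y ω| ^ 3) (P θ) ∧ ∫ ω, |Y ω| ^ 3 ∂P θ ≤ T) :
    |supMean P (fun ω => -g (x + Y ω)) + heat (c ^ 2) g x| ≤ M * (T + 2 * (c : ℝ) ^ 3) := by
  have h1 := abs_heat_sq_sub_le_of_taylor (c := c) hL hM hT
  have h2 : |supMean P (fun ω => -g (x + Y ω)) - (-g x + b * supMean P (fun ω => -Y ω ^ 2))|
      ≤ M * T := by
    refine abs_iSup_sub_affine_le hb (hY.lipschitz_comp (hL.const_add_comp x).neg).bddAbove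
      (bddAbove_integral_neg_sq P Y) fun θ => ?_
    have h4 := (abs_integral_sub_le_of_taylor hL hT (hY.memLp θ) (h0 θ) (h3 θ).1).trans
      (mul_le_mul_of_nonneg_left (h3 θ).2 hM)
    rw [integral_neg, integral_neg, ← abs_neg]
    refine le_of_eq_of_le (congrArg _ ?_) h4
    ring
  rw [hvar] at h2
  rw [abs_le] at h1 h2 ⊢
  constructor <;> linarith [h1.1, h1.2, h2.1, h2.2]

/-- The Taylor bound is used when the remaining variance `s` dominates, the trivial one
otherwise. -/
theorem ofReal_le_of_le_of_le {D : ℝ} {s σ : ℝ≥0} {M : ℝ≥0∞} (hσ : c ≤ σ) (hA : D ≤ K * c)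
    (hB : s ≠ 0 → M ≠ ∞ → D ≤ K / (3 * s) * (M.toReal + 2 * (c : ℝ) ^ 3)) :
    ENNReal.ofReal D ≤
      K * ((ENNReal.ofReal (2 * (c : ℝ) ^ 2 * σ) + M) / ENNReal.ofReal ((c : ℝ) ^ 2 + s)) := by
  have hc0 : (0 : ℝ) ≤ c := c.2
  have hs0 : (0 : ℝ) ≤ s := s.2
  have hK0 : (0 : ℝ) ≤ K := K.2
  have hσ' : (c : ℝ) ≤ σ := by exact_mod_cast hσ
  -- Here `D ≤ 0`, so the degenerate quotients with `c = s = 0` need no analysis.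
  by_cases hKc : (K : ℝ) * c = 0
  · rw [ENNReal.ofReal_of_nonpos (hA.trans hKc.le)]
    exact zero_le
  have hK : (0 : ℝ) < K := lt_of_le_of_ne hK0 fun h => hKc (by rw [← h, zero_mul])
  have hc : (0 : ℝ) < c := lt_of_le_of_ne hc0 fun h => hKc (by rw [← h, mul_zero])
  have hpos : 0 < (c : ℝ) ^ 2 + s := by positivity
  have e : ∀ m : ℝ, 0 ≤ m →
      K * ((ENNReal.ofReal (2 * (c : ℝ) ^ 2 * σ) + ENNReal.ofReal m) /
        ENNReal.ofReal ((c : ℝ) ^ 2 + s)) =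
      ENNReal.ofReal (K * ((2 * (c : ℝ) ^ 2 * σ + m) / ((c : ℝ) ^ 2 + s))) := fun m hm => by
    rw [ENNReal.ofReal_mul hK0, ENNReal.ofReal_div_of_pos hpos,
      ENNReal.ofReal_add (by positivity) hm, ENNReal.ofReal_coe_nnreal]
  have hcσ : 2 * (c : ℝ) ^ 2 * c ≤ 2 * (c : ℝ) ^ 2 * σ := by gcongr
  -- If `s ≤ c²`, then `c² + s ≤ 2c²`, so `c ≤ 2c³ / (c² + s)`. If `c² ≤ s`, then `c² + s ≤ 2s ≤
  -- 3s`, and the Taylor bound suffices.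
  rcases le_total (s : ℝ) ((c : ℝ) ^ 2) with h | h
  · calc ENNReal.ofReal D
        ≤ ENNReal.ofReal (K * ((2 * (c : ℝ) ^ 2 * σ + 0) / ((c : ℝ) ^ 2 + s))) := by
          refine ENNReal.ofReal_le_ofReal (hA.trans (mul_le_mul_of_nonneg_left ?_ hK0))
          rw [le_div_iff₀ hpos]
          nlinarith
      _ ≤ _ := by
          rw [← e 0 le_rfl, ENNReal.ofReal_zero]
          gcongr
          exact zero_le
  · have hs : (0 : ℝ) < s := lt_of_lt_of_le (by positivity) h
    rcases eq_or_ne M ∞ with rfl | hM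
    · rw [add_top, ENNReal.top_div_of_ne_top ENNReal.ofReal_ne_top,
        ENNReal.mul_top (by exact_mod_cast hK.ne')]
      exact le_top
    · have hB' := hB (by exact_mod_cast hs.ne') hM
      have hm : 0 ≤ M.toReal := ENNReal.toReal_nonneg
      rw [← ENNReal.ofReal_toReal hM, e _ hm]
      refine ENNReal.ofReal_le_ofReal (hB'.trans ?_)
      rw [div_mul_eq_mul_div, mul_div_assoc]
      refine mul_le_mul_of_nonneg_left ?_ hK0
      refine div_le_div₀ (by positivity) ?_ hpos (by linarith)
      linarith [hcσ, (by ring : 2 * (c : ℝ) ^ 2 * c = 2 * (c : ℝ) ^ 3)]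

theorem edist_supMean_heat_le_of_convexOn [Nonempty Θ] (hY : SqBdd P Y)
    (h0 : ∀ θ, ∫ ω, Y ω ∂P θ = 0) (hg : ConvexOn ℝ Set.univ g) (hL : LipschitzWith K g)
    (hvar : supMean P (fun ω => Y ω ^ 2) = (c : ℝ) ^ 2) (s : ℝ≥0) (x : ℝ) :
    edist (supMean P fun ω => heat s g (x + Y ω)) (heat (c ^ 2) (heat s g) x) ≤
      K * ((ENNReal.ofReal (2 * (c : ℝ) ^ 3) + (sublinExp P fun ω => |Y ω| ^ 3).toENNReal) /
        ENNReal.ofReal ((c : ℝ) ^ 2 + s)) := by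
  rw [edist_dist, Real.dist_eq]
  have e : 2 * (c : ℝ) ^ 3 = 2 * (c : ℝ) ^ 2 * c := by ring
  rw [e]
  have hgs := hg.heat hL s
  refine ofReal_le_of_le_of_le le_rfl
    (hgs.abs_supMean_sub_heat_le hY h0 (hL.heat s) hvar x) fun hs hM => ?_
  obtain ⟨a, b, hT⟩ := hL.exists_taylor_heat hs x
  exact abs_supMean_sub_heat_le_of_taylor hY h0 (hL.heat s) hvar (hgs.nonneg_of_taylor hT)
    (by positivity) hT fun θ => integrable_abs_cube_of_sublinExp_ne_top hY.measurable hM θ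

theorem heat_neg (s : ℝ≥0) (f : ℝ → ℝ) : heat s (fun x => -f x) = fun x => -heat s f x := by
  ext x
  simp only [heat, integral_neg]

/-- The convex estimates are applied to `-g`. The upper deviation `σ` enters only through `2c³ ≤
2c²σ`. -/
theorem edist_supMean_heat_le_of_concaveOn [Nonempty Θ] (hY : SqBdd P Y)
    (h0 : ∀ θ, ∫ ω, Y ω ∂P θ = 0) (hg : ConcaveOn ℝ Set.univ g) (hL : LipschitzWith K g)
    (hvar : supMean P (fun ω => -Y ω ^ 2) = -(c : ℝ) ^ 2) {σ : ℝ≥0} (hσ : c ≤ σ) (s : ℝ≥0)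
    (x : ℝ) :
    edist (supMean P fun ω => heat s g (x + Y ω)) (heat (c ^ 2) (heat s g) x) ≤
      K * ((ENNReal.ofReal (2 * (c : ℝ) ^ 2 * σ) + (sublinExp P fun ω => |Y ω| ^ 3).toENNReal) /
        ENNReal.ofReal ((c : ℝ) ^ 2 + s)) := by
  obtain ⟨f, rfl⟩ : ∃ f : ℝ → ℝ, g = fun x => -f x := ⟨fun x => -g x, by simp⟩
  have hf : ConvexOn ℝ Set.univ f := neg_concaveOn_iff.1 hg
  have hLf : LipschitzWith K f := fun x y => by simpa using hL x y
  have hfs := hf.heat hLf s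
  rw [heat_neg, heat_neg, edist_dist, Real.dist_eq, sub_neg_eq_add]
  refine ofReal_le_of_le_of_le hσ
    (hfs.abs_supMean_neg_add_heat_le hY h0 (hLf.heat s) hvar x) fun hs hM => ?_
  obtain ⟨a, b, hT⟩ := hLf.exists_taylor_heat hs x
  exact abs_supMean_neg_add_heat_le_of_taylor hY h0 (hLf.heat s) hvar (hfs.nonneg_of_taylor hT)
    (by positivity) hT fun θ => integrable_abs_cube_of_sublinExp_ne_top hY.measurable hM θ

end OneStep

/-! ### Assembly -/

section Assembly

variable {Θ Ω : Type*} [Nonempty Θ] [MeasurableSpace Ω] {P : Θ → Measure Ω}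
  [∀ θ, IsProbabilityMeasure (P θ)]

theorem IndepSeq.edist_supMean_heat_le_sum {n : ℕ} {X : Fin n → Ω → ℝ} (hind : IndepSeq P X) {μ : ℝ}
    (hX : ∀ i, SqBdd P fun ω => X i ω - μ) {f : ℝ → ℝ} {K : ℝ≥0} (hf : LipschitzWith K f)
    (v : Fin n → ℝ≥0) (δ : Fin n → ℝ≥0∞)
    (hstep : ∀ i x, edist (supMean P fun ω => heat (∑ j ∈ Finset.Ioi i, v j) f (x + (X i ω - μ)))
      (heat (v i) (heat (∑ j ∈ Finset.Ioi i, v j) f) x) ≤ δ i) :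
    edist (supMean P fun ω => f (∑ i, (X i ω - μ))) (heat (∑ i, v i) f 0) ≤ ∑ i, δ i := by
  -- The values at indices `≥ n` are placeholders: only indices below `n` enter the telescoping sum.
  let Y : ℕ → Ω → ℝ := fun k ω => if h : k < n then X ⟨k, h⟩ ω - μ else 0
  let w : ℕ → ℝ≥0 := fun k => if h : k < n then v ⟨k, h⟩ else 0
  let ε : ℕ → ℝ≥0∞ := fun k => if h : k < n then δ ⟨k, h⟩ else 0
  have hYi : ∀ i (hi : i < n), Y i = fun ω => X ⟨i, hi⟩ ω - μ := fun i hi => by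
    ext ω
    simp [Y, hi]
  have htail : ∀ i (hi : i < n),
      ∑ j ∈ Finset.Ico (i + 1) n, w j = ∑ j ∈ Finset.Ioi (⟨i, hi⟩ : Fin n), v j := fun i hi => by
    have h1 : (Finset.Ioi (⟨i, hi⟩ : Fin n)).map Fin.valEmbedding = Finset.Ico (i + 1) n := by
      ext j
      simp only [Finset.mem_map, Finset.mem_Ioi, Fin.valEmbedding_apply, Finset.mem_Ico]
      constructor
      · rintro ⟨k, hk, rfl⟩
        exact ⟨hk, k.2⟩
      · rintro ⟨h1, h2⟩
        exact ⟨⟨j, h2⟩, h1, rfl⟩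
    rw [← h1, Finset.sum_map]
    simp [w]
  have key := _root_.edist_supMean_heat_le_sum (P := P) (Y := Y) (n := n)
    (fun i hi => by rw [hYi i hi]; exact hX _) (fun i hi => ?_) hf w ε (fun i hi x => ?_)
  · simpa [Finset.sum_range, Y, w, ε] using key
  · have h := (hind ⟨i, hi⟩).comp (a := fun u => ∑ j, (u j - μ)) (b := fun y => y - μ)
      (by fun_prop) (by fun_prop)
    rw [hYi i hi]
    convert h using 2 with ω
    rw [Finset.sum_range]
    refine Finset.sum_congr rfl fun j _ => ?_
    simp only [Y, dif_pos (j.2.trans hi)]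
    rfl
  · have h := hstep ⟨i, hi⟩ x
    rw [htail i hi, hYi i hi]
    simpa [w, ε, hi] using h

theorem coe_sum_Ici_sq {n : ℕ} (c : Fin n → ℝ≥0) (i : Fin n) :
    ∑ j ∈ Finset.Ici i, (c j : ℝ) ^ 2 = (c i : ℝ) ^ 2 + (∑ j ∈ Finset.Ioi i, c j ^ 2 : ℝ≥0) := by
  rw [← Finset.Ioi_insert, Finset.sum_insert (by simp)]
  push_cast
  rfl

/-- Rescaling by the total standard deviation. -/
theorem abs_sublinExp_sub_le_of_edist_le {n : ℕ} {Y : Fin n → Ω → ℝ} (hY : ∀ i, SqBdd P (Y i))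
    {φ : ℝ → ℝ} {K : ℝ≥0} (hφ : LipschitzWith K φ) {B : ℝ} (hB : 0 < B) {v : Fin n → ℝ≥0}
    (hv : ∑ i, (v i : ℝ) = B ^ 2) {δ : Fin n → ℝ≥0∞}
    (h : ∀ L : ℝ≥0, LipschitzWith L (fun y => φ (y / B)) →
      edist (supMean P fun ω => φ ((∑ i, Y i ω) / B)) (heat (∑ i, v i) (fun y => φ (y / B)) 0) ≤
        ∑ i, L * δ i) :
    (sublinExp P (fun ω => φ (∑ i, Y i ω / B))
        - ((∫ z, φ z ∂(gaussianReal 0 1) : ℝ) : EReal)).abs ≤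
      derivNorm φ / ENNReal.ofReal B * ∑ i, δ i := by
  obtain ⟨hfin, hD⟩ := hφ.lipschitzWith_derivNorm
  set D := (derivNorm φ).toNNReal with hDdef
  have hB' : B.toNNReal ≠ 0 := (Real.toNNReal_pos.2 hB).ne'
  have hL : LipschitzWith (D / B.toNNReal) (fun y => φ (y / B)) := by
    refine LipschitzWith.of_dist_le_mul fun x y => (hD.dist_le_mul _ _).trans (le_of_eq ?_)
    rw [Real.dist_eq, Real.dist_eq, ← sub_div, abs_div, abs_of_pos hB, NNReal.coe_div,
      Real.coe_toNNReal B hB.le]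
    ring
  have key := h _ hL
  have e1 : sublinExp P (fun ω => φ (∑ i, Y i ω / B)) =
      ((supMean P fun ω => φ ((∑ i, Y i ω) / B) : ℝ) : EReal) := by
    simp_rw [← Finset.sum_div]
    exact ((SqBdd.sum Finset.univ fun i _ => hY i).lipschitz_comp hL).sublinExp_eq
  -- A centred Gaussian of variance `B ^ 2`, divided by `B`, is standard.
  have e2 : heat (∑ i, v i) (fun y => φ (y / B)) 0 = ∫ z, φ z ∂gaussianReal 0 1 := by
    have hm := gaussianReal_map_div_const (μ := 0) (v := ∑ i, v i) B
    have h1 : (∑ i, v i) / NNReal.mk (B ^ 2) (sq_nonneg _) = 1 := by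
      ext
      rw [NNReal.coe_div, NNReal.coe_mk, NNReal.coe_sum, hv, NNReal.coe_one]
      exact div_self (by positivity)
    rw [zero_div, h1] at hm
    rw [← hm, integral_map (by fun_prop) hφ.continuous.aestronglyMeasurable]
    simp [heat]
  have e3 : ((D / B.toNNReal : ℝ≥0) : ℝ≥0∞) = derivNorm φ / ENNReal.ofReal B := by
    rw [ENNReal.coe_div hB', hDdef, ENNReal.coe_toNNReal hfin]
    rfl
  rw [e2, ← Finset.mul_sum, e3, edist_dist, Real.dist_eq] at key
  rw [e1, ← EReal.coe_sub, EReal.abs_def]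
  exact key

end Assembly

theorem theorem3p1 {Θ Ω : Type*} [Nonempty Θ] [MeasurableSpace Ω]
    (P : Θ → Measure Ω) [∀ θ, IsProbabilityMeasure (P θ)]
    (n : ℕ) (X : Fin n → Ω → ℝ) (hX : ∀ i, Measurable (X i)) (hindep : IndepSeq P X)
    (μ : ℝ) (σup σlow : Fin n → ℝ) (hσup : ∀ i, 0 ≤ σup i) (hσlow : ∀ i, 0 ≤ σlow i)
    (hmean_up : ∀ i, sublinExp P (X i) = (μ : EReal))
    (hmean_low : ∀ i, -sublinExp P (fun ω => -X i ω) = (μ : EReal))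
    (hvar_up : ∀ i, sublinExp P (fun ω => (X i ω - μ) ^ 2) = ((σup i ^ 2 : ℝ) : EReal))
    (hvar_low : ∀ i, -sublinExp P (fun ω => -(X i ω - μ) ^ 2) = ((σlow i ^ 2 : ℝ) : EReal))
    (Bup Blow : ℝ) (hBup : ∑ i, σup i ^ 2 = Bup ^ 2) (hBlow : ∑ i, σlow i ^ 2 = Blow ^ 2) :
    (0 < Bup → ∀ φ : ℝ → ℝ, (∃ K : ℝ≥0, LipschitzWith K φ) → ConvexOn ℝ Set.univ φ →
      (sublinExp P (fun ω => φ (∑ i, (X i ω - μ) / Bup))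
          - ((∫ z, φ z ∂(gaussianReal 0 1) : ℝ) : EReal)).abs ≤
        derivNorm φ / ENNReal.ofReal Bup *
          ∑ i, (ENNReal.ofReal (2 * σup i ^ 3)
              + (sublinExp P (fun ω => |X i ω - μ| ^ 3)).toENNReal) /
            ENNReal.ofReal (∑ j ∈ Finset.Ici i, σup j ^ 2)) ∧
    (0 < Blow → ∀ φ : ℝ → ℝ, (∃ K : ℝ≥0, LipschitzWith K φ) → ConcaveOn ℝ Set.univ φ →
      (sublinExp P (fun ω => φ (∑ i, (X i ω - μ) / Blow))
          - ((∫ z, φ z ∂(gaussianReal 0 1) : ℝ) : EReal)).abs ≤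
        derivNorm φ / ENNReal.ofReal Blow *
          ∑ i, (ENNReal.ofReal (2 * σlow i ^ 2 * σup i)
              + (sublinExp P (fun ω => |X i ω - μ| ^ 3)).toENNReal) /
            ENNReal.ofReal (∑ j ∈ Finset.Ici i, σlow j ^ 2)) := by
  lift σup to Fin n → ℝ≥0 using hσup
  lift σlow to Fin n → ℝ≥0 using hσlow
  have hsq : ∀ i θ, Integrable (fun ω => (X i ω - μ) ^ 2) (P θ) ∧
      ∫ ω, (X i ω - μ) ^ 2 ∂P θ ≤ (σup i : ℝ) ^ 2 := fun i =>
    integrable_of_sublinExp_le (((hX i).sub_const μ).pow_const 2) (fun ω => sq_nonneg _)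
      (hvar_up i).le
  have hY : ∀ i, SqBdd P fun ω => X i ω - μ := fun i =>
    ⟨(hX i).sub_const μ, (σup i : ℝ) ^ 2, hsq i⟩
  -- Equality of the upper and lower means forces every `P θ` to give `X i` the mean `μ`.
  have h0 : ∀ i θ, ∫ ω, (X i ω - μ) ∂P θ = 0 := fun i θ => by
    have hXi : Integrable (X i) (P θ) := by
      have h := ((hY i).integrable θ).add (integrable_const μ)
      exact h.congr (.of_forall fun ω => sub_add_cancel _ _)
    have h1 := (le_iSup (fun θ => extExp (P θ) (X i)) θ).trans (hmean_up i).le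
    have h2 := (le_iSup (fun θ => extExp (P θ) (fun ω => -X i ω)) θ).trans
      (neg_eq_iff_eq_neg.1 (hmean_low i)).le
    rw [extExp_eq_integral hXi] at h1
    rw [extExp_eq_integral hXi.fun_neg, integral_neg] at h2
    have h3 : ∫ ω, X i ω ∂P θ ≤ μ := by exact_mod_cast h1
    have h4 : -∫ ω, X i ω ∂P θ ≤ -μ := by exact_mod_cast h2
    rw [integral_sub hXi (integrable_const μ)]
    simp
    linarith
  have hup : ∀ i, supMean P (fun ω => (X i ω - μ) ^ 2) = (σup i : ℝ) ^ 2 := fun i => by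
    have h := hvar_up i
    rw [sublinExp_eq_supMean (fun θ => (hsq i θ).1) (hY i).bddAbove_sq] at h
    exact_mod_cast h
  have hlow : ∀ i, supMean P (fun ω => -(X i ω - μ) ^ 2) = -(σlow i : ℝ) ^ 2 := fun i => by
    have h := neg_eq_iff_eq_neg.1 (hvar_low i)
    rw [sublinExp_eq_supMean (fun θ => (hsq i θ).1.fun_neg) (bddAbove_integral_neg_sq P _)] at h
    exact_mod_cast h
  -- The second moment under any single `θ` lies between the two variances.
  have hle : ∀ i, σlow i ≤ σup i := fun i => by
    obtain ⟨θ⟩ := ‹Nonempty Θ›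
    have h1 := le_ciSup (bddAbove_integral_neg_sq P fun ω => X i ω - μ) θ
    have h2 : ∫ ω, -(X i ω - μ) ^ 2 ∂P θ ≤ -(σlow i : ℝ) ^ 2 := h1.trans (hlow i).le
    rw [integral_neg] at h2
    have h3 : (σlow i : ℝ) ^ 2 ≤ (σup i : ℝ) ^ 2 := (neg_le_neg_iff.1 h2).trans (hsq i θ).2
    exact_mod_cast abs_le_of_sq_le_sq' h3 (σup i).2 |>.2
  refine ⟨fun hB φ ⟨K, hφ⟩ hc => ?_, fun hB φ ⟨K, hφ⟩ hc => ?_⟩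
  · refine abs_sublinExp_sub_le_of_edist_le hY hφ hB (v := fun i => σup i ^ 2)
      (by simpa using hBup) fun L hL => hindep.edist_supMean_heat_le_sum hY hL _ _ fun i x => ?_
    have hcB : ConvexOn ℝ Set.univ fun y => φ (y / Bup) := by
      have := hc.comp_linearMap (LinearMap.mulRight ℝ Bup⁻¹)
      simpa [Function.comp_def, div_eq_mul_inv] using this
    rw [coe_sum_Ici_sq]
    exact edist_supMean_heat_le_of_convexOn (hY i) (h0 i) hcB hL (hup i) _ x
  · refine abs_sublinExp_sub_le_of_edist_le hY hφ hB (v := fun i => σlow i ^ 2)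
      (by simpa using hBlow) fun L hL => hindep.edist_supMean_heat_le_sum hY hL _ _ fun i x => ?_
    have hcB : ConcaveOn ℝ Set.univ fun y => φ (y / Blow) := by
      have := hc.comp_linearMap (LinearMap.mulRight ℝ Blow⁻¹)
      simpa [Function.comp_def, div_eq_mul_inv] using this
    rw [coe_sum_Ici_sq]
    exact edist_supMean_heat_le_of_concaveOn (hY i) (h0 i) hcB hL (hlow i) (hle i) _ x
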